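/- Let $d\ge 1$ and let $P=\mathrm{conv}\{\pm e_1,\dots,\pm e_d\}\subset\mathbb{R}^d$ be the $d$-dimensional crosspolytope, whose $2d$ vertices come in $d$ antipodal pairs $\{e_i,-e_i\}$. Let $O$ be an acyclic orientation of the edge graph of $P$. Call $O$ an LP-orientation if there are a polytope $Q\subset\mathbb{R}^d$, an isomorphism from the face lattice of $P$ to the face lattice of $Q$, and a linear functional $f$ on $\mathbb{R}^d$ such that, for every edge $vw$ of $P$, with corresponding vertices $v',w'$ of $Q$, the edge is oriented from $v$ to $w$ in $O$ if and only if $f(v')<f(w')$. (a) $O$ is an LP-orientation if and only if there is no set $S$ of vertices of $P$ which is a union of antipodal pairs, is neither empty nor the whole vertex set, and is such that every edge between a vertex $x\in S$ and a vertex $y\notin S$ is oriented from $x$ to $y$. (b) Label the vertices bijectively by $1,\dots,2d$ so that every edge is oriented towards its endpoint with the larger label. The labels of the antipodal pairs partition $\{1,\dots,2d\}$ into $d$ pairs; list these in ascending order of their smaller elements. Such a labeling exists, and the resulting sequence of pairs, the pair sequence of $O$, does not depend on the choice of the labeling. Moreover, $O$ is an LP-orientation if and only if for no $k$ with $0<k<d$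 the union of the first $k$ pairs of the pair sequence is $\{1,\dots,2k\}$. -/

import Mathlib

/-! ### Polytopes, their faces, their graphs -/

/-- A (convex) polytope: the convex hull of finitely many points. -/
def IsPolytope {d : ℕ} (P : Set (Fin d → ℝ)) : Prop :=
  ∃ s : Finset (Fin d → ℝ), P = convexHull ℝ (s : Set (Fin d → ℝ))

/-- The faces of `P`, ordered by inclusion: the subsets of `P` on which some linear functional
attains its maximum over `P` (this includes `P` itself), together with the empty face. -/
abbrev PolytopeFace {d : ℕ} (P : Set (Fin d → ℝ)) : Type :=
  {F : Set (Fin d → ℝ) // IsExposed ℝ P F}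

/-- The vertices of `P`: the points `x` such that `{x}` is a face. -/
abbrev PolytopeVertex {d : ℕ} (P : Set (Fin d → ℝ)) : Type :=
  {x : Fin d → ℝ // IsExposed ℝ P {x}}

/-- A vertex, regarded as a face. -/
def PolytopeVertex.toFace {d : ℕ} {P : Set (Fin d → ℝ)} (v : PolytopeVertex P) :
    PolytopeFace P :=
  ⟨{(v : Fin d → ℝ)}, v.2⟩

/-- The edge graph of `P`: two distinct vertices are adjacent iff the segment joining them is a
face of `P`. -/
def polytopeGraph {d : ℕ} (P : Set (Fin d → ℝ)) : SimpleGraph (PolytopeVertex P) where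
  Adj v w := v ≠ w ∧ IsExposed ℝ P (segment ℝ (v : Fin d → ℝ) (w : Fin d → ℝ))
  symm := ⟨fun v w h => ⟨h.1.symm, by rw [segment_symm]; exact h.2⟩⟩
  loopless := ⟨fun _ h => h.1 rfl⟩

/-! ### Orientations -/

/-- An orientation of a graph: every edge gets exactly one of its two directions. -/
structure EdgeOrientation {V : Type*} (G : SimpleGraph V) where
  /-- `Dir v w`: there is an edge `vw` and it is oriented from `v` to `w`. -/
  Dir : V → V → Prop
  adj_of_dir : ∀ v w, Dir v w → G.Adj v w
  dir_iff_not : ∀ v w, G.Adj v w → (Dir v w ↔ ¬ Dir w v)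

/-- There is no directed cycle. -/
def EdgeOrientation.IsAcyclic {V : Type*} {G : SimpleGraph V} (O : EdgeOrientation G) : Prop :=
  ∀ v, ¬ Relation.TransGen O.Dir v v

/-- `O` is an LP-orientation of (the combinatorial type of) `P`: there are a polytope `Q` in the
same space, an isomorphism `φ` from the face lattice of `P` to that of `Q`, acting on vertices as
`e`, and a linear functional `f` such that every edge `vw` is oriented from `v` to `w` iff
`f` is smaller at the vertex of `Q` corresponding to `v` than at the one corresponding to `w`. -/
def IsLPOrientation {d : ℕ} {P : Set (Fin d → ℝ)} (O : EdgeOrientation (polytopeGraph P)) :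
    Prop :=
  ∃ Q : Set (Fin d → ℝ), IsPolytope Q ∧
    ∃ φ : PolytopeFace P ≃o PolytopeFace Q,
    ∃ e : PolytopeVertex P → PolytopeVertex Q,
    ∃ f : (Fin d → ℝ) →ₗ[ℝ] ℝ,
      (∀ v, φ v.toFace = (e v).toFace) ∧
      ∀ v w, (polytopeGraph P).Adj v w → (O.Dir v w ↔ f (e v) < f (e w))

/-! ### The crosspolytope -/

/-- The standard `d`-dimensional crosspolytope: the convex hull of the points `± eᵢ`. -/
def crosspolytope (d : ℕ) : Set (Fin d → ℝ) :=
  convexHull ℝ {x | ∃ i : Fin d, x = Pi.single i 1 ∨ x = -Pi.single i 1}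

/-- `v` and `w` form one of the `d` natural pairs of vertices of the crosspolytope. -/
def IsAntipodalPair {d : ℕ} (v w : PolytopeVertex (crosspolytope d)) : Prop :=
  (w : Fin d → ℝ) = -(v : Fin d → ℝ)

/-- `S` is a union of antipodal pairs. -/
def IsUnionOfPairs {d : ℕ} (S : Set (PolytopeVertex (crosspolytope d))) : Prop :=
  ∀ v w, IsAntipodalPair v w → v ∈ S → w ∈ S

/-- `S` is an initial set: all edges between `x ∈ S` and `y ∉ S` are oriented towards `y`. -/
def EdgeOrientation.IsInitialSet {V : Type*} {G : SimpleGraph V} (O : EdgeOrientation G)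
    (S : Set V) : Prop :=
  ∀ x ∈ S, ∀ y ∉ S, G.Adj x y → O.Dir x y

/-! ### Pair sequences -/

/-- A partition of `{1, …, 2d}` into `d` pairs `(fst i, snd i)`, each pair written with its smaller
element first, and the pairs listed in ascending order of smaller element. (The `2d` entries
exhaust `{1, …, 2d}`, so they are pairwise distinct.) -/
@[ext]
structure PairSequence (d : ℕ) where
  fst : Fin d → ℕ
  snd : Fin d → ℕ
  fst_lt_snd : ∀ i, fst i < snd i
  strictMono_fst : StrictMono fst
  mem_iff : ∀ n, n ∈ Set.Icc 1 (2 * d) ↔ ∃ i, n = fst i ∨ n = snd i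

/-- The set of the elements of the first `k` pairs. -/
def PairSequence.firstPairs {d : ℕ} (s : PairSequence d) (k : ℕ) : Set ℕ :=
  {n | ∃ i : Fin d, (i : ℕ) < k ∧ (n = s.fst i ∨ n = s.snd i)}

/-- `s` is the pair sequence of `O`: for some labeling `ℓ` of the vertices by `1, …, 2d` such that
all edges are oriented towards the larger label, the pairs of `s` are the pairs of labels of
antipodal vertices. -/
def IsPairSequenceOf {d : ℕ} (O : EdgeOrientation (polytopeGraph (crosspolytope d)))
    (s : PairSequence d) : Prop :=
  ∃ ℓ : PolytopeVertex (crosspolytope d) → ℕ,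
    Set.BijOn ℓ Set.univ (Set.Icc 1 (2 * d)) ∧
    (∀ v w, O.Dir v w → ℓ v < ℓ w) ∧
    ∀ i, ∃ v w, IsAntipodalPair v w ∧ ℓ v = s.fst i ∧ ℓ w = s.snd i

/-! ### Crosspolytopal point configurations -/

/-! Vertices are labelled `(i, b)`, where `i` names the antipodal pair. A splitting is a set of
pairs, neither empty nor full, all of whose members precede all the other pairs. The core is
`isLPOrientation_iff`: `O` is an LP-orientation iff there is no splitting.

Necessity (`not_separated_of_transversal`): suppose `f` puts some pairs of a realization below a
hyperplane and the others above it. Move the origin to a point of that hyperplane strictly inside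
every transversal facet. Each pair then has a combination lying in the kernel of `f`; these are `d`
vectors in dimension `d - 1`, hence dependent. Evaluating the dependence at the transversal facet
given by the signs of its coefficients, and at the opposite facet, gives two strict inequalities
that contradict each other.

Sufficiency: take a topological labeling and regard each pair as an interval of labels. Without a
splitting, every interval except the first starts inside an earlier one, which yields a tree
(`IsLabeling.exists_parent`). Put the pairs on segments parallel to the axes, each crossing its
parent's segment at a point interior to both. Supporting functionals of all transversals are built
recursively along the tree, and a supporting hyperplane containing one segment contains the crossing
points and so every segment. The sum of the coordinates recovers the labels up to a constant.

For (b), the two labels of a pair are determined by the numbers of predecessors in other pairs, so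
the pair sequence is unique; the splittings are exactly its initial segments that fill some `{1, …,
2k}`. -/

/-- A configuration of `d` pairs of points whose convex hull has the face lattice of the
crosspolytope: every transversal of the pairs is cut out by a supporting hyperplane, and a
supporting hyperplane that contains a pair contains all the points. -/
structure IsCrossConfig {d : ℕ} (c : Fin d × Bool → Fin d → ℝ) : Prop where
  transversal : ∀ σ : Fin d → Bool, ∃ (g : (Fin d → ℝ) →ₗ[ℝ] ℝ) (γ : ℝ),
    ∀ i, g (c (i, σ i)) = γ ∧ g (c (i, !σ i)) < γ
  pair : ∀ (g : (Fin d → ℝ) →ₗ[ℝ] ℝ) (γ : ℝ), (∀ k, g (c k) ≤ γ) →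
    ∀ i, (∀ b, g (c (i, b)) = γ) → ∀ k, g (c k) = γ

/-- The label sets of faces: everything, or at most one label of every pair. -/
def IsFaceLabelSet {d : ℕ} (A : Set (Fin d × Bool)) : Prop :=
  A = Set.univ ∨ ∀ i b, (i, b) ∈ A → (i, !b) ∉ A

/-! ### Exposed faces of the convex hull of a family of points -/

theorem mem_convexHull_image_of_eq_max {ι E : Type*} [AddCommGroup E] [Module ℝ E] {c : ι → E}
    {g : E →ₗ[ℝ] ℝ} {γ : ℝ} {A : Set ι} (hle : ∀ k, g (c k) ≤ γ)
    (hA : ∀ k, g (c k) = γ → k ∈ A) {x : E} (hx : x ∈ convexHull ℝ (Set.range c))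
    (hgx : g x = γ) : x ∈ convexHull ℝ (c '' A) := by
  -- The right-hand set is convex: a combination with positive weights attains the maximum `γ` only
  -- if both of its points do.
  have hsub : convexHull ℝ (Set.range c) ⊆
      {x | g x ≤ γ ∧ (g x = γ → x ∈ convexHull ℝ (c '' A))} := by
    refine convexHull_min ?_ ?_
    · rintro _ ⟨k, rfl⟩
      exact ⟨hle k, fun h => subset_convexHull ℝ _ ⟨k, hA k h, rfl⟩⟩
    · rw [convex_iff_forall_pos]
      rintro x ⟨hx, hx'⟩ y ⟨hy, hy'⟩ a b ha hb hab
      have hval : g (a • x + b • y) = a * g x + b * g y := by simp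
      have hγ : γ = a * γ + b * γ := by rw [← add_mul, hab, one_mul]
      refine ⟨?_, fun h => ?_⟩
      · rw [hval, hγ]; gcongr
      · rw [hval] at h
        have h1 : g x = γ := by
          by_contra hne
          have := lt_of_le_of_ne hx hne
          nlinarith
        have h2 : g y = γ := by
          by_contra hne
          have := lt_of_le_of_ne hy hne
          nlinarith
        exact (convex_convexHull ℝ _) (hx' h1) (hy' h2) ha.le hb.le hab
  exact (hsub hx).2 hgx

theorem le_of_mem_convexHull_range {ι E : Type*} [AddCommGroup E] [Module ℝ E] {c : ι → E}
    {g : E →ₗ[ℝ] ℝ} {γ : ℝ} (hle : ∀ k, g (c k) ≤ γ) {x : E}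
    (hx : x ∈ convexHull ℝ (Set.range c)) : g x ≤ γ := by
  refine convexHull_min (t := {x | g x ≤ γ}) ?_ (convex_halfSpace_le g.isLinear γ) hx
  rintro _ ⟨k, rfl⟩
  exact hle k

theorem eq_of_mem_convexHull_image {ι E : Type*} [AddCommGroup E] [Module ℝ E] {c : ι → E}
    {g : E →ₗ[ℝ] ℝ} {γ : ℝ} {A : Set ι} (hA : ∀ k ∈ A, g (c k) = γ) {x : E}
    (hx : x ∈ convexHull ℝ (c '' A)) : g x = γ := by
  refine convexHull_min (t := {x | g x = γ}) ?_ (convex_hyperplane g.isLinear γ) hx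
  rintro _ ⟨k, hk, rfl⟩
  exact hA k hk

theorem isExposed_convexHull_image {ι : Type*} {d : ℕ} {c : ι → Fin d → ℝ}
    {g : (Fin d → ℝ) →ₗ[ℝ] ℝ} {γ : ℝ} {A : Set ι} (hle : ∀ k, g (c k) ≤ γ)
    (hA : ∀ k, g (c k) = γ ↔ k ∈ A) :
    IsExposed ℝ (convexHull ℝ (Set.range c)) (convexHull ℝ (c '' A)) := by
  intro hne
  refine ⟨LinearMap.toContinuousLinearMap g, Set.ext fun x => ⟨fun hx => ?_, fun hx => ?_⟩⟩
  · refine ⟨convexHull_mono (Set.image_subset_range _ _) hx, fun y hy => ?_⟩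
    simp only [LinearMap.coe_toContinuousLinearMap']
    rw [eq_of_mem_convexHull_image (fun k hk => (hA k).2 hk) hx]
    exact le_of_mem_convexHull_range hle hy
  · obtain ⟨_, k, hk, rfl⟩ := convexHull_nonempty_iff.1 hne
    refine mem_convexHull_image_of_eq_max hle (fun k => (hA k).1) hx.1 (le_antisymm ?_ ?_)
    · exact le_of_mem_convexHull_range hle hx.1
    · rw [← (hA k).2 hk]
      exact hx.2 _ (subset_convexHull ℝ _ ⟨k, rfl⟩)

/-- A nonempty exposed face is the set where a functional attains its maximal value. -/
theorem IsExposed.exists_functional {ι : Type*} {d : ℕ} {c : ι → Fin d → ℝ}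
    {F : Set (Fin d → ℝ)} (hF : IsExposed ℝ (convexHull ℝ (Set.range c)) F) (hne : F.Nonempty) :
    ∃ (g : (Fin d → ℝ) →ₗ[ℝ] ℝ) (γ : ℝ), (∀ k, g (c k) ≤ γ) ∧
      F = {x ∈ convexHull ℝ (Set.range c) | g x = γ} := by
  obtain ⟨l, hl⟩ := hF hne
  obtain ⟨z, hz⟩ := hne
  have hz' := hz
  rw [hl] at hz'
  refine ⟨l.toLinearMap, l z, fun k => hz'.2 _ (subset_convexHull ℝ _ ⟨k, rfl⟩), ?_⟩
  rw [hl]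
  ext x
  constructor
  · rintro ⟨hx, hx'⟩
    exact ⟨hx, le_antisymm (hz'.2 x hx) (hx' z hz'.1)⟩
  · rintro ⟨hx, hx'⟩
    refine ⟨hx, fun y hy => ?_⟩
    have : l x = l z := hx'
    rw [this]
    exact hz'.2 y hy

theorem IsExposed.eq_convexHull_image {ι : Type*} {d : ℕ} {c : ι → Fin d → ℝ}
    {F : Set (Fin d → ℝ)} (hF : IsExposed ℝ (convexHull ℝ (Set.range c)) F) :
    F = convexHull ℝ (c '' (c ⁻¹' F)) := by
  rcases F.eq_empty_or_nonempty with rfl | hne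
  · simp
  obtain ⟨g, γ, hle, hFg⟩ := hF.exists_functional hne
  refine subset_antisymm (fun x hx => ?_) ?_
  · have hx' := hx
    rw [hFg] at hx'
    refine mem_convexHull_image_of_eq_max hle (fun k hk => ?_) hx'.1 hx'.2
    rw [Set.mem_preimage, hFg]
    exact ⟨subset_convexHull ℝ _ ⟨k, rfl⟩, hk⟩
  · exact convexHull_min (Set.image_preimage_subset _ _) (hF.convex (convex_convexHull ℝ _))

/-! ### The face lattice of a crosspolytopal configuration -/

namespace IsCrossConfig

variable {d : ℕ} {c : Fin d × Bool → Fin d → ℝ}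

theorem exists_functional_of_isFaceLabelSet (hc : IsCrossConfig c) {A : Set (Fin d × Bool)}
    (hA : IsFaceLabelSet A) : ∃ (g : (Fin d → ℝ) →ₗ[ℝ] ℝ) (γ : ℝ), (∀ k, g (c k) ≤ γ) ∧
      ∀ k, g (c k) = γ ↔ k ∈ A := by
  classical
  rcases hA with rfl | hA
  · exact ⟨0, 0, by simp, by simp⟩
  -- Two transversals that agree exactly on `A`: in a pair missing `A`, the first takes `false` and
  -- the second `true`. The sum of their functionals is then maximal exactly on `A`.
  obtain ⟨g, γ, hg⟩ := hc.transversal fun i => decide ((i, true) ∈ A)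
  obtain ⟨h, η, hh⟩ := hc.transversal fun i => !decide ((i, false) ∈ A)
  have key : ∀ k, (g (c k) ≤ γ ∧ h (c k) ≤ η) ∧ (g (c k) = γ ∧ h (c k) = η ↔ k ∈ A) := by
    rintro ⟨i, b⟩
    have h1 := hg i
    have h2 := hh i
    have h3 := hA i true
    by_cases ht : (i, true) ∈ A <;> by_cases hf : (i, false) ∈ A <;> cases b <;>
      simp [ht, hf] at h1 h2 h3 ⊢ <;>
      refine ⟨⟨?_, ?_⟩, ?_⟩ <;> first | linarith | skip
    all_goals first
      | (constructor <;> linarith)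
      | (intro _; apply ne_of_lt; linarith)
  refine ⟨g + h, γ + η, fun k => ?_, fun k => ?_⟩
  · simpa using add_le_add (key k).1.1 (key k).1.2
  · rw [← (key k).2]
    obtain ⟨⟨h1, h2⟩, _⟩ := key k
    simp only [LinearMap.add_apply]
    constructor
    · intro h3; constructor <;> linarith
    · rintro ⟨h3, h4⟩; rw [h3, h4]

theorem isExposed (hc : IsCrossConfig c) {A : Set (Fin d × Bool)} (hA : IsFaceLabelSet A) :
    IsExposed ℝ (convexHull ℝ (Set.range c)) (convexHull ℝ (c '' A)) := by
  obtain ⟨g, γ, h1, h2⟩ := hc.exists_functional_of_isFaceLabelSet hA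
  exact isExposed_convexHull_image h1 h2

theorem preimage_convexHull_image (hc : IsCrossConfig c) {A : Set (Fin d × Bool)}
    (hA : IsFaceLabelSet A) : c ⁻¹' convexHull ℝ (c '' A) = A := by
  obtain ⟨g, γ, h1, h2⟩ := hc.exists_functional_of_isFaceLabelSet hA
  refine subset_antisymm (fun k hk => ?_) fun k hk => subset_convexHull ℝ _ ⟨k, hk, rfl⟩
  exact (h2 k).1 (eq_of_mem_convexHull_image (fun k hk => (h2 k).2 hk) hk)

theorem isFaceLabelSet_preimage (hc : IsCrossConfig c) {F : Set (Fin d → ℝ)}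
    (hF : IsExposed ℝ (convexHull ℝ (Set.range c)) F) : IsFaceLabelSet (c ⁻¹' F) := by
  rcases F.eq_empty_or_nonempty with rfl | hne
  · right; simp
  obtain ⟨g, γ, hle, hFg⟩ := hF.exists_functional hne
  have hmem : ∀ k, c k ∈ F ↔ g (c k) = γ := fun k => by
    rw [hFg]
    exact and_iff_right (subset_convexHull ℝ _ ⟨k, rfl⟩)
  by_cases h : ∃ i, ∀ b, c (i, b) ∈ F
  · obtain ⟨i, hi⟩ := h
    left
    exact Set.eq_univ_of_forall fun k =>
      (hmem k).2 (hc.pair g γ hle i (fun b => (hmem _).1 (hi b)) k)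
  · right
    intro i b h1 h2
    refine h ⟨i, fun b' => ?_⟩
    rcases Bool.eq_or_eq_not b' b with rfl | rfl
    exacts [h1, h2]

/-- The faces of a crosspolytopal configuration correspond to their label sets. -/
def faceIso (hc : IsCrossConfig c) {P : Set (Fin d → ℝ)} (hP : P = convexHull ℝ (Set.range c)) :
    PolytopeFace P ≃o {A : Set (Fin d × Bool) // IsFaceLabelSet A} where
  toFun F := ⟨c ⁻¹' F.1, hc.isFaceLabelSet_preimage (hP ▸ F.2)⟩
  invFun A := ⟨convexHull ℝ (c '' A.1), hP ▸ hc.isExposed A.2⟩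
  left_inv F := by
    have hF : IsExposed ℝ (convexHull ℝ (Set.range c)) F.1 := hP ▸ F.2
    exact Subtype.ext hF.eq_convexHull_image.symm
  right_inv A := Subtype.ext (hc.preimage_convexHull_image A.2)
  map_rel_iff' := by
    intro F G
    constructor
    · intro h
      have hF : IsExposed ℝ (convexHull ℝ (Set.range c)) F.1 := hP ▸ F.2
      have hG : IsExposed ℝ (convexHull ℝ (Set.range c)) G.1 := hP ▸ G.2
      change F.1 ⊆ G.1
      rw [hF.eq_convexHull_image, hG.eq_convexHull_image]
      exact convexHull_mono (Set.image_mono h)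
    · intro h
      exact Set.preimage_mono h

theorem isFaceLabelSet_singleton (k : Fin d × Bool) : IsFaceLabelSet {k} := by
  right
  rintro i b rfl h
  simp at h

theorem injective (hc : IsCrossConfig c) : Function.Injective c := by
  intro k l h
  have := hc.preimage_convexHull_image (isFaceLabelSet_singleton l)
  rw [Set.image_singleton, convexHull_singleton] at this
  have hk : k ∈ c ⁻¹' {c l} := h
  rwa [this] at hk

theorem isExposed_singleton (hc : IsCrossConfig c) {P : Set (Fin d → ℝ)}
    (hP : P = convexHull ℝ (Set.range c)) (k : Fin d × Bool) : IsExposed ℝ P {c k} := by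
  have := hc.isExposed (isFaceLabelSet_singleton k)
  rwa [Set.image_singleton, convexHull_singleton, ← hP] at this

/-- The vertices of a crosspolytopal configuration. -/
def vertex (hc : IsCrossConfig c) {P : Set (Fin d → ℝ)}
    (hP : P = convexHull ℝ (Set.range c)) (k : Fin d × Bool) : PolytopeVertex P :=
  ⟨c k, hc.isExposed_singleton hP k⟩

theorem vertex_bijective (hc : IsCrossConfig c) {P : Set (Fin d → ℝ)}
    (hP : P = convexHull ℝ (Set.range c)) : Function.Bijective (hc.vertex hP) := by
  refine ⟨fun k l h => hc.injective (congrArg Subtype.val h), fun ⟨x, hx⟩ => ?_⟩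
  rw [hP] at hx
  have h : ({x} : Set (Fin d → ℝ)).Nonempty := Set.singleton_nonempty x
  rw [hx.eq_convexHull_image, convexHull_nonempty_iff] at h
  obtain ⟨_, k, hk, rfl⟩ := h
  exact ⟨k, Subtype.ext hk⟩

theorem faceIso_toFace (hc : IsCrossConfig c) {P : Set (Fin d → ℝ)}
    (hP : P = convexHull ℝ (Set.range c)) (k : Fin d × Bool) :
    hc.faceIso hP (hc.vertex hP k).toFace = ⟨{k}, isFaceLabelSet_singleton k⟩ := by
  apply Subtype.ext
  change c ⁻¹' {c k} = {k}
  ext l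
  exact hc.injective.eq_iff

theorem adj_vertex (hc : IsCrossConfig c) {P : Set (Fin d → ℝ)}
    (hP : P = convexHull ℝ (Set.range c)) {k l : Fin d × Bool} (h : k.1 ≠ l.1) :
    (polytopeGraph P).Adj (hc.vertex hP k) (hc.vertex hP l) := by
  refine ⟨fun hkl => h (congrArg Prod.fst ((hc.vertex_bijective hP).1 hkl)), ?_⟩
  have hA : IsFaceLabelSet {k, l} := by
    right
    intro i b h1 h2
    simp only [Set.mem_insert_iff, Set.mem_singleton_iff, Prod.ext_iff] at h1 h2
    rcases h1 with ⟨rfl, rfl⟩ | ⟨rfl, rfl⟩ <;> rcases h2 with ⟨h3, h4⟩ | ⟨h3, h4⟩ <;> simp_all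
  have := hc.isExposed hA
  rwa [Set.image_pair, convexHull_pair, ← hP] at this

end IsCrossConfig

/-! ### Necessity: a functional cannot separate pairs from pairs -/

/-- Evaluating at a relation between the differences of pairs the functional that supports the
transversal `σ`. -/
theorem sum_abs_mul_sub_neg {d : ℕ} {E : Type*} [AddCommGroup E] [Module ℝ E]
    {q : Fin d × Bool → E} {g : E →ₗ[ℝ] ℝ} {γ : ℝ} (hγ : 0 < γ) {σ : Fin d → Bool}
    (hg : ∀ i, g (q (i, σ i)) = γ ∧ g (q (i, !σ i)) < γ) {w : Fin d × Bool → ℝ}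
    (hw : ∀ k, 0 < w k) {a : Fin d → ℝ} (ha : ∀ i, 0 ≤ a i) (ha' : ∃ i, a i ≠ 0)
    (h0 : ∑ i, a i • (w (i, !σ i) • q (i, σ i) - w (i, σ i) • q (i, !σ i)) = 0) :
    ∑ i, a i * (w (i, !σ i) - w (i, σ i)) < 0 := by
  have h1 := congrArg g h0
  simp only [map_sum, map_smul, map_sub, smul_eq_mul, map_zero] at h1
  have h2 : ∑ i, a i * (w (i, !σ i) - w (i, σ i)) * γ <
      ∑ i, a i * (w (i, !σ i) * g (q (i, σ i)) - w (i, σ i) * g (q (i, !σ i))) := by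
    have hterm : ∀ i, a i * (w (i, !σ i) * g (q (i, σ i)) - w (i, σ i) * g (q (i, !σ i))) -
        a i * (w (i, !σ i) - w (i, σ i)) * γ = a i * (w (i, σ i) * (γ - g (q (i, !σ i)))) := by
      intro i
      rw [(hg i).1]; ring
    have hpos : ∀ i, 0 < w (i, σ i) * (γ - g (q (i, !σ i))) := fun i =>
      mul_pos (hw _) (sub_pos.2 (hg i).2)
    obtain ⟨j, hj⟩ := ha'
    refine Finset.sum_lt_sum (fun i _ => ?_) ⟨j, Finset.mem_univ j, ?_⟩
    · have := mul_nonneg (ha i) (hpos i).le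
      have := hterm i
      linarith
    · have := mul_pos (lt_of_le_of_ne (ha j) hj.symm) (hpos j)
      have := hterm j
      linarith
  rw [h1, ← Finset.sum_mul] at h2
  by_contra hcon
  have := mul_nonneg (not_lt.1 hcon) hγ.le
  linarith

/-- No linear functional separates some of the pairs of a crosspolytopal configuration from the
others. -/
theorem not_separated_of_transversal {d : ℕ} {q : Fin d × Bool → Fin d → ℝ}
    (hq : ∀ σ : Fin d → Bool, ∃ (g : (Fin d → ℝ) →ₗ[ℝ] ℝ) (γ : ℝ),
      ∀ i, g (q (i, σ i)) = γ ∧ g (q (i, !σ i)) < γ)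
    (f : (Fin d → ℝ) →ₗ[ℝ] ℝ) {T : Set (Fin d)} (hT : T.Nonempty) (hT' : T ≠ Set.univ)
    (hf : ∀ i ∈ T, ∀ j ∉ T, ∀ b b', f (q (i, b)) < f (q (j, b'))) : False := by
  classical
  obtain ⟨i₀, hi₀⟩ := hT
  obtain ⟨j₀, hj₀⟩ := (Set.ne_univ_iff_exists_notMem T).1 hT'
  obtain ⟨lo, hlo, hlo'⟩ := (Finset.univ.filter fun k : Fin d × Bool => k.1 ∈ T).exists_max_image
    (fun k => f (q k)) ⟨(i₀, true), by simpa using hi₀⟩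
  obtain ⟨hi, hhi, hhi'⟩ := (Finset.univ.filter fun k : Fin d × Bool => k.1 ∉ T).exists_min_image
    (fun k => f (q k)) ⟨(j₀, true), by simpa using hj₀⟩
  simp only [Finset.mem_filter, Finset.mem_univ, true_and] at hlo hlo' hhi hhi'
  have hlohi : f (q lo) < f (q hi) := hf lo.1 hlo hi.1 hhi lo.2 hi.2
  obtain ⟨C, hC1, hC2⟩ := exists_between hlohi
  have hbelow : ∀ i ∈ T, ∀ b, f (q (i, b)) < C := fun i hi b => (hlo' (i, b) hi).trans_lt hC1
  have habove : ∀ j ∉ T, ∀ b, C < f (q (j, b)) := fun j hj b => hC2.trans_le (hhi' (j, b) hj)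
  let A : ℝ := f (q (i₀, true)) + f (q (i₀, false))
  let B : ℝ := f (q (j₀, true)) + f (q (j₀, false))
  have hA : A < 2 * C := by
    have := hbelow i₀ hi₀ true
    have := hbelow i₀ hi₀ false
    simp only [A]; linarith
  have hB : 2 * C < B := by
    have := habove j₀ hj₀ true
    have := habove j₀ hj₀ false
    simp only [B]; linarith
  -- The weights make `o` a convex combination of the two chosen pairs, one on each side, with `f o
  -- = C`.
  let x : ℝ := (B - 2 * C) / (B - A) / 2
  let y : ℝ := (2 * C - A) / (B - A) / 2
  have hx : 0 < x := div_pos (div_pos (by linarith) (by linarith)) two_pos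
  have hy : 0 < y := div_pos (div_pos (by linarith) (by linarith)) two_pos
  have hBA : B - A ≠ 0 := by linarith
  have hxy : 2 * x + 2 * y = 1 := by simp only [x, y]; field_simp; ring
  have hxyC : x * A + y * B = C := by simp only [x, y]; field_simp; ring
  let o : Fin d → ℝ := x • (q (i₀, true) + q (i₀, false)) + y • (q (j₀, true) + q (j₀, false))
  have hfo : f o = C := by
    rw [← hxyC]; simp [o, A, B, mul_add]
  let q' : Fin d × Bool → Fin d → ℝ := fun k => q k - o
  have hpair : ∀ {g : (Fin d → ℝ) →ₗ[ℝ] ℝ} {γ : ℝ} {σ : Fin d → Bool},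
      (∀ i, g (q (i, σ i)) = γ ∧ g (q (i, !σ i)) < γ) → ∀ i,
      g (q (i, true)) + g (q (i, false)) < 2 * γ := by
    intro g γ σ hg i
    have := hg i
    cases h : σ i <;> simp only [h, Bool.not_true, Bool.not_false] at this <;> linarith
  have hq' : ∀ σ : Fin d → Bool, ∃ (g : (Fin d → ℝ) →ₗ[ℝ] ℝ) (γ : ℝ), 0 < γ ∧
      ∀ i, g (q' (i, σ i)) = γ ∧ g (q' (i, !σ i)) < γ := by
    intro σ
    obtain ⟨g, γ, hg⟩ := hq σ
    refine ⟨g, γ - g o, ?_, fun i => ?_⟩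
    -- The point `o` averages two full pairs, and no transversal facet contains a full pair, so `g o
    -- < γ`.
    · have h1 := mul_lt_mul_of_pos_left (hpair hg i₀) hx
      have h2 := mul_lt_mul_of_pos_left (hpair hg j₀) hy
      have h3 : g o = x * (g (q (i₀, true)) + g (q (i₀, false))) +
        y * (g (q (j₀, true)) + g (q (j₀, false))) := by simp [o, mul_add]
      have h4 : x * (2 * γ) + y * (2 * γ) = γ := by
        linear_combination γ * hxy
      linarith
    · simp only [q', map_sub]
      exact ⟨by rw [(hg i).1], by linarith [(hg i).2]⟩
  have hf' : ∀ k, f (q' k) = f (q k) - C := fun k => by simp only [q', map_sub, hfo]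
  let w : Fin d × Bool → ℝ := fun k => |f (q' k)|
  have hw : ∀ k, 0 < w k := by
    rintro ⟨i, b⟩
    refine abs_pos.2 ?_
    rw [hf']
    by_cases hi : i ∈ T
    · exact (sub_neg.2 (hbelow i hi b)).ne
    · exact (sub_pos.2 (habove i hi b)).ne'
  -- Both points of a pair lie on the same side of the hyperplane, so weighting each by the distance
  -- `|f|` of the other cancels `f`.
  let z : Fin d → Fin d → ℝ := fun i =>
    w (i, false) • q' (i, true) - w (i, true) • q' (i, false)
  have hz : ∀ i, f (z i) = 0 := by
    intro i
    simp only [z, w, map_sub, map_smul, smul_eq_mul]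
    by_cases hi : i ∈ T
    · rw [abs_of_neg, abs_of_neg]
      · ring
      · rw [hf']; exact sub_neg.2 (hbelow i hi _)
      · rw [hf']; exact sub_neg.2 (hbelow i hi _)
    · rw [abs_of_pos, abs_of_pos]
      · ring
      · rw [hf']; exact sub_pos.2 (habove i hi _)
      · rw [hf']; exact sub_pos.2 (habove i hi _)
  have hdep : ¬ LinearIndependent ℝ z := by
    intro hli
    have hspan := hli.span_eq_top_of_card_eq_finrank' (by simp)
    have hf0 : f = 0 := LinearMap.ext_on_range hspan fun i => by simp [hz]
    simp [hf0] at hlohi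
  obtain ⟨a, ha, ha'⟩ := Fintype.not_linearIndependent_iff.1 hdep
  -- Swapping the roles in pair `i` negates `z i`; choosing the transversal by sign makes all
  -- coefficients nonnegative.
  let σ : Fin d → Bool := fun i => decide (0 ≤ a i)
  have habs : ∀ i, a i • z i =
      |a i| • (w (i, !σ i) • q' (i, σ i) - w (i, σ i) • q' (i, !σ i)) := by
    intro i
    rcases le_or_gt 0 (a i) with h | h
    · simp [σ, z, h, abs_of_nonneg h]
    · simp only [σ, z, not_le.2 h, abs_of_neg h, decide_false, Bool.not_false]
      rw [neg_smul, ← smul_neg, neg_sub]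
  have ha'' : ∃ i, |a i| ≠ 0 := ha'.imp fun i hi => abs_ne_zero.2 hi
  simp only [habs] at ha
  obtain ⟨g, γ, hγ, hg⟩ := hq' σ
  obtain ⟨h, η, hη, hh⟩ := hq' fun i => !σ i
  have h1 := sum_abs_mul_sub_neg hγ hg hw (fun i => abs_nonneg (a i)) ha'' ha
  have h2 := sum_abs_mul_sub_neg hη hh hw (fun i => abs_nonneg (a i)) ha'' (by
    rw [← neg_eq_zero, ← Finset.sum_neg_distrib, ← ha]
    refine Finset.sum_congr rfl fun i _ => ?_
    rw [← smul_neg, neg_sub, Bool.not_not])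
  have h3 := add_neg h1 h2
  -- Passing to the opposite transversal negates every summand, so two negative sums would add up to
  -- zero.
  rw [← Finset.sum_add_distrib, Finset.sum_eq_zero] at h3
  · exact lt_irrefl _ h3
  · intro i _
    rw [Bool.not_not]; ring
/-! ### Labelings and pair sequences -/

/-- The other label of the same pair. -/
def flipLabel {d : ℕ} (k : Fin d × Bool) : Fin d × Bool := (k.1, !k.2)

theorem flipLabel_ne {d : ℕ} (k : Fin d × Bool) : flipLabel k ≠ k := by
  obtain ⟨i, b⟩ := k
  simp [flipLabel]

theorem flipLabel_flipLabel {d : ℕ} (k : Fin d × Bool) : flipLabel (flipLabel k) = k := by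
  simp [flipLabel]

theorem eq_or_eq_flipLabel {d : ℕ} {k l : Fin d × Bool} (h : k.1 = l.1) :
    k = l ∨ k = flipLabel l := by
  obtain ⟨i, b⟩ := k
  obtain ⟨j, b'⟩ := l
  obtain rfl : i = j := h
  cases b <;> cases b' <;> simp [flipLabel]

/-- A relation that orients every pair of labels from different pairs. -/
def IsMultipartite {d : ℕ} (R : Fin d × Bool → Fin d × Bool → Prop) : Prop :=
  ∀ k l, k.1 ≠ l.1 → (R k l ↔ ¬ R l k)

/-- A numbering by `1, …, 2d` along which `R` increases. -/
structure IsLabeling {d : ℕ} (R : Fin d × Bool → Fin d × Bool → Prop)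
    (ℓ : Fin d × Bool → ℕ) : Prop where
  bijOn : Set.BijOn ℓ Set.univ (Set.Icc 1 (2 * d))
  lt_of_rel : ∀ k l, R k l → ℓ k < ℓ l

/-- Topological sorting: acyclicity makes the reflexive transitive closure antisymmetric, a linear
extension exists, and ranks in it, shifted to start at `1`, are the labels. -/
theorem exists_bijOn_of_acyclic {α : Type*} [Fintype α] {R : α → α → Prop}
    (hR : ∀ k, ¬ Relation.TransGen R k k) :
    ∃ ℓ : α → ℕ, Set.BijOn ℓ Set.univ (Set.Icc 1 (Fintype.card α)) ∧ ∀ k l, R k l → ℓ k < ℓ l := by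
  classical
  let r : α → α → Prop := Relation.ReflTransGen R
  have hpo : IsPartialOrder α r :=
    { refl := fun _ => Relation.ReflTransGen.refl
      trans := fun _ _ _ => Relation.ReflTransGen.trans
      antisymm := fun a b hab hba => by
        rcases Relation.reflTransGen_iff_eq_or_transGen.1 hab with h | h
        · exact h.symm
        · exact absurd (h.trans_left hba) (hR a) }
  obtain ⟨s, hs, hrs⟩ := extend_partialOrder r
  let inst : LinearOrder α :=
    { le := s
      le_refl := hs.refl
      le_trans := hs.trans
      le_antisymm := hs.antisymm
      le_total := hs.total
      toDecidableLE := Classical.decRel _ }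
  let e : Fin (Fintype.card α) ≃o α := monoEquivOfFin α rfl
  refine ⟨fun k => (e.symm k : ℕ) + 1, ⟨?_, ?_, ?_⟩, ?_⟩
  · intro k _
    have := (e.symm k).2
    simp only [Set.mem_Icc]; omega
  · intro k _ l _ h
    have : e.symm k = e.symm l := Fin.ext (by simpa using h)
    exact e.symm.injective this
  · intro n hn
    simp only [Set.mem_Icc] at hn
    refine ⟨e ⟨n - 1, by omega⟩, Set.mem_univ _, ?_⟩
    simp only [OrderIso.symm_apply_apply]; omega
  · intro k l hkl
    have hle : k ≤ l := hrs _ _ (Relation.ReflTransGen.single hkl)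
    have hne : k ≠ l := by
      rintro rfl
      exact hR k (Relation.TransGen.single hkl)
    have : e.symm k < e.symm l := e.symm.strictMono (lt_of_le_of_ne hle hne)
    simpa using this

theorem exists_isLabeling {d : ℕ} {R : Fin d × Bool → Fin d × Bool → Prop}
    (hR : ∀ k, ¬ Relation.TransGen R k k) : ∃ ℓ, IsLabeling R ℓ := by
  obtain ⟨ℓ, h1, h2⟩ := exists_bijOn_of_acyclic hR
  have hcard : Fintype.card (Fin d × Bool) = 2 * d := by simp [mul_comm]
  exact ⟨ℓ, hcard ▸ h1, h2⟩

/-- The number of predecessors in other pairs. -/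
noncomputable def outerInDegree {d : ℕ} (R : Fin d × Bool → Fin d × Bool → Prop)
    (k : Fin d × Bool) : ℕ := {l | l.1 ≠ k.1 ∧ R l k}.ncard

namespace IsLabeling

variable {d : ℕ} {R : Fin d × Bool → Fin d × Bool → Prop} {ℓ : Fin d × Bool → ℕ}

theorem injective (h : IsLabeling R ℓ) : Function.Injective ℓ :=
  Set.injOn_univ.1 h.bijOn.injOn

theorem mem_Icc (h : IsLabeling R ℓ) (k : Fin d × Bool) : ℓ k ∈ Set.Icc 1 (2 * d) :=
  h.bijOn.mapsTo (Set.mem_univ k)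

theorem exists_eq (h : IsLabeling R ℓ) {n : ℕ} (hn : n ∈ Set.Icc 1 (2 * d)) : ∃ k, ℓ k = n := by
  obtain ⟨k, -, hk⟩ := h.bijOn.surjOn hn
  exact ⟨k, hk⟩

theorem rel_iff_lt (h : IsLabeling R ℓ) (hR : IsMultipartite R) {k l : Fin d × Bool}
    (hkl : k.1 ≠ l.1) : R k l ↔ ℓ k < ℓ l := by
  refine ⟨h.lt_of_rel k l, fun hlt => (hR k l hkl).2 fun hr => ?_⟩
  exact lt_asymm hlt (h.lt_of_rel l k hr)

theorem ncard_lt (h : IsLabeling R ℓ) (k : Fin d × Bool) :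
    {l | ℓ l < ℓ k}.ncard + 1 = ℓ k := by
  have himg : ℓ '' {l | ℓ l < ℓ k} = (Finset.Ico 1 (ℓ k) : Set ℕ) := by
    ext n
    simp only [Set.mem_image, Set.mem_ofPred_eq, Finset.coe_Ico, Set.mem_Ico]
    constructor
    · rintro ⟨l, hl, rfl⟩
      exact ⟨(h.mem_Icc l).1, hl⟩
    · rintro ⟨h1, h2⟩
      obtain ⟨l, rfl⟩ := h.exists_eq ⟨h1, h2.le.trans (h.mem_Icc k).2⟩
      exact ⟨l, h2, rfl⟩
  rw [← Set.ncard_image_of_injective _ h.injective, himg, Set.ncard_coe_finset, Nat.card_Ico]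
  have := (h.mem_Icc k).1
  omega

/-- A label is one more than the number of smaller labels. These come from the predecessors in other
pairs and, for the larger label of a pair, also from its partner; hence the `+ 1` and `+ 2`. -/
theorem eq_outerInDegree_of_lt (h : IsLabeling R ℓ) (hR : IsMultipartite R) {k : Fin d × Bool}
    (hk : ℓ k < ℓ (flipLabel k)) :
    ℓ k = outerInDegree R k + 1 ∧ ℓ (flipLabel k) = outerInDegree R (flipLabel k) + 2 := by
  constructor
  · rw [← h.ncard_lt k, outerInDegree]
    congr 2
    ext l
    refine ⟨fun hl => ?_, fun hl => h.lt_of_rel _ _ hl.2⟩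
    have hne : l.1 ≠ k.1 := by
      intro he
      simp only [Set.mem_ofPred_eq] at hl
      rcases eq_or_eq_flipLabel he with rfl | rfl <;> omega
    exact ⟨hne, (h.rel_iff_lt hR hne).2 hl⟩
  · have hset : {l | ℓ l < ℓ (flipLabel k)} =
        insert k {l | l.1 ≠ (flipLabel k).1 ∧ R l (flipLabel k)} := by
      ext l
      simp only [Set.mem_ofPred_eq, Set.mem_insert_iff]
      constructor
      · intro hl
        by_cases he : l.1 = k.1
        · rcases eq_or_eq_flipLabel he with rfl | rfl
          · exact Or.inl rfl
          · exact absurd hl (lt_irrefl _)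
        · exact Or.inr ⟨he, (h.rel_iff_lt hR (l := flipLabel k) he).2 hl⟩
      · rintro (rfl | hl)
        · exact hk
        · exact h.lt_of_rel _ _ hl.2
    rw [← h.ncard_lt, hset, Set.ncard_insert_of_notMem, outerInDegree]
    rintro ⟨h1, -⟩
    exact h1 rfl

/-- The numbers of a pair do not depend on the labeling. -/
theorem eq_min_max_of_lt (h : IsLabeling R ℓ) (hR : IsMultipartite R) {k : Fin d × Bool}
    (hk : ℓ k < ℓ (flipLabel k)) :
    ℓ k = min (outerInDegree R (k.1, true)) (outerInDegree R (k.1, false)) + 1 ∧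
    ℓ (flipLabel k) = max (outerInDegree R (k.1, true)) (outerInDegree R (k.1, false)) + 2 := by
  obtain ⟨h1, h2⟩ := h.eq_outerInDegree_of_lt hR hk
  obtain ⟨i, b⟩ := k
  cases b <;> simp only [flipLabel, Bool.not_true, Bool.not_false] at * <;> omega

/-- The pairs of `s` are the pairs of numbers of `ℓ`. -/
def HasPairs (ℓ : Fin d × Bool → ℕ) (s : PairSequence d) : Prop :=
  ∀ i, ∃ k, ℓ k = s.fst i ∧ ℓ (flipLabel k) = s.snd i

theorem exists_hasPairs (h : IsLabeling R ℓ) : ∃ s, HasPairs ℓ s := by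
  classical
  have hsel : ∀ i : Fin d, ∃ k : Fin d × Bool, k.1 = i ∧ ℓ k < ℓ (flipLabel k) := by
    intro i
    rcases lt_or_gt_of_ne (h.injective.ne (flipLabel_ne (i, true))) with hlt | hlt
    · exact ⟨flipLabel (i, true), rfl, by rwa [flipLabel_flipLabel]⟩
    · exact ⟨(i, true), rfl, hlt⟩
  choose κ hκ1 hκ2 using hsel
  have hinj : Function.Injective fun i => ℓ (κ i) := by
    intro i j hij
    rw [← hκ1 i, ← hκ1 j, h.injective hij]
  -- The increasing enumeration of the smaller labels supplies the order of the pairs.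
  let A : Finset ℕ := Finset.univ.image fun i => ℓ (κ i)
  have hA : A.card = d := by
    rw [Finset.card_image_of_injective _ hinj, Finset.card_univ, Fintype.card_fin]
  have hpre : ∀ i, ∃ j, ℓ (κ j) = A.orderEmbOfFin hA i := by
    intro i
    obtain ⟨j, -, hj⟩ := Finset.mem_image.1 (Finset.orderEmbOfFin_mem A hA i)
    exact ⟨j, hj⟩
  choose ρ hρ using hpre
  have hρsurj : Function.Surjective ρ := by
    apply Finite.surjective_of_injective
    intro i j hij
    apply (A.orderEmbOfFin hA).injective
    rw [← hρ, ← hρ, hij]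
  refine ⟨⟨fun i => ℓ (κ (ρ i)), fun i => ℓ (flipLabel (κ (ρ i))), fun i => hκ2 _, ?_, ?_⟩,
    fun i => ⟨κ (ρ i), rfl, rfl⟩⟩
  · simp only [hρ]
    exact (A.orderEmbOfFin hA).strictMono
  · intro n
    constructor
    · intro hn
      obtain ⟨k, rfl⟩ := h.exists_eq hn
      obtain ⟨i, hi⟩ := hρsurj k.1
      refine ⟨i, ?_⟩
      rw [hi]
      rcases eq_or_eq_flipLabel (hκ1 k.1).symm with hk | hk
      · left; rw [← hk]
      · right; rw [← hk]
    · rintro ⟨i, rfl | rfl⟩ <;> exact h.mem_Icc _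

theorem range_fst_subset {ℓ' : Fin d × Bool → ℕ} (h : IsLabeling R ℓ) (h' : IsLabeling R ℓ')
    (hR : IsMultipartite R) {s s' : PairSequence d} (hs : HasPairs ℓ s) (hs' : HasPairs ℓ' s')
    (i : Fin d) : ∃ j, s'.fst j = s.fst i ∧ s'.snd j = s.snd i := by
  obtain ⟨k, hk1, hk2⟩ := hs i
  obtain ⟨h1, h2⟩ := h.eq_min_max_of_lt hR (k := k) (by rw [hk1, hk2]; exact s.fst_lt_snd i)
  obtain ⟨j, hj⟩ := (s'.mem_iff (ℓ' k)).1 (h'.mem_Icc k)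
  obtain ⟨l, hl1, hl2⟩ := hs' j
  obtain ⟨h3, h4⟩ := h'.eq_min_max_of_lt hR (k := l) (by rw [hl1, hl2]; exact s'.fst_lt_snd j)
  have hlk : l.1 = k.1 := by
    rcases hj with hj | hj
    · rw [← hl1] at hj; rw [h'.injective hj]
    · rw [← hl2] at hj; rw [h'.injective hj]; rfl
  refine ⟨j, ?_, ?_⟩
  · rw [← hl1, ← hk1, h1, h3, hlk]
  · rw [← hl2, ← hk2, h2, h4, hlk]

theorem hasPairs_unique {ℓ' : Fin d × Bool → ℕ} (h : IsLabeling R ℓ) (h' : IsLabeling R ℓ')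
    (hR : IsMultipartite R) {s s' : PairSequence d} (hs : HasPairs ℓ s) (hs' : HasPairs ℓ' s') :
    s = s' := by
  have hfst : s.fst = s'.fst := by
    refine (s.strictMono_fst.range_inj s'.strictMono_fst).1 (subset_antisymm ?_ ?_)
    · rintro _ ⟨i, rfl⟩
      obtain ⟨j, hj, -⟩ := h.range_fst_subset h' hR hs hs' i
      exact ⟨j, hj⟩
    · rintro _ ⟨i, rfl⟩
      obtain ⟨j, hj, -⟩ := h'.range_fst_subset h hR hs' hs i
      exact ⟨j, hj⟩
  refine PairSequence.ext hfst (funext fun i => ?_)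
  obtain ⟨j, hj, hj'⟩ := h.range_fst_subset h' hR hs hs' i
  rw [hfst] at hj
  rw [← hj', s'.strictMono_fst.injective hj]

end IsLabeling

/-! ### Splittings read off from a labeling -/

/-- Some of the pairs, neither none nor all, precede all the others. -/
def IsSplitting {d : ℕ} (R : Fin d × Bool → Fin d × Bool → Prop) (T : Set (Fin d)) : Prop :=
  T.Nonempty ∧ T ≠ Set.univ ∧ ∀ i ∈ T, ∀ j ∉ T, ∀ b b', R (i, b) (j, b')

theorem IsLabeling.exists_isSplitting_iff {d : ℕ} {R : Fin d × Bool → Fin d × Bool → Prop}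
    {ℓ : Fin d × Bool → ℕ} (h : IsLabeling R ℓ) (hR : IsMultipartite R) {s : PairSequence d}
    (hs : HasPairs ℓ s) :
    (∃ T, IsSplitting R T) ↔ ∃ k, 0 < k ∧ k < d ∧ s.firstPairs k = Set.Icc 1 (2 * k) := by
  choose κ hκ1 hκ2 using hs
  have hinj : Function.Injective fun i => (κ i).1 := by
    intro i j hij
    rcases eq_or_eq_flipLabel hij with he | he
    · apply s.strictMono_fst.injective
      rw [← hκ1, ← hκ1, he]
    · have h1 := s.fst_lt_snd i
      have h2 := s.fst_lt_snd j
      rw [← hκ1, ← hκ2] at h1 h2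
      rw [he, flipLabel_flipLabel] at h1
      omega
  have hsurj : Function.Surjective fun i => (κ i).1 := Finite.surjective_of_injective hinj
  have hmem : ∀ (i : Fin d) (k : Fin d × Bool), k.1 = (κ i).1 ↔ (ℓ k = s.fst i ∨ ℓ k = s.snd i) := by
    intro i k
    rw [← hκ1, ← hκ2, h.injective.eq_iff, h.injective.eq_iff]
    refine ⟨eq_or_eq_flipLabel, ?_⟩
    rintro (rfl | rfl) <;> rfl
  have hfirst : ∀ (n : ℕ) (i : Fin d) (k : Fin d × Bool), k.1 = (κ i).1 →
      (ℓ k ∈ s.firstPairs n ↔ (i : ℕ) < n) := by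
    intro n i k hk
    constructor
    · rintro ⟨j, hj, hj'⟩
      rw [← hmem, hk] at hj'
      rwa [hinj hj']
    · intro hi
      exact ⟨i, hi, (hmem i k).1 hk⟩
  constructor
  · rintro ⟨T, ⟨t, ht⟩, hT, hsplit⟩
    obtain ⟨u, hu⟩ := (Set.ne_univ_iff_exists_notMem T).1 hT
    have hlower : ∀ i j : Fin d, (κ i).1 ∈ T → (κ j).1 ∉ T → i < j := by
      intro i j hi hj
      rw [← s.strictMono_fst.lt_iff_lt, ← hκ1, ← hκ1]
      exact h.lt_of_rel _ _ (hsplit _ hi _ hj (κ i).2 (κ j).2)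
    obtain ⟨j₀, rfl⟩ := hsurj u
    obtain ⟨i₀, rfl⟩ := hsurj t
    obtain ⟨m, hm, hmin⟩ := WellFounded.has_min (wellFounded_lt (α := Fin d))
      {j | (κ j).1 ∉ T} ⟨j₀, hu⟩
    -- In the order of the sequence, `T` is an initial segment; `m` is the first pair outside it.
    have hTm : ∀ i, (κ i).1 ∈ T ↔ i < m := fun i =>
      ⟨fun hi => hlower i m hi hm, fun hi => by
        by_contra hcon
        exact hmin i hcon hi⟩
    have hmemT : ∀ k : Fin d × Bool, ℓ k ∈ s.firstPairs m ↔ k.1 ∈ T := by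
      intro k
      obtain ⟨i, hi⟩ := hsurj k.1
      rw [hfirst m i k hi.symm, ← hi, hTm]
      rfl
    have hsub : ∀ n ∈ s.firstPairs m, ∃ k, ℓ k = n := by
      rintro n ⟨i, -, rfl | rfl⟩
      exacts [⟨_, hκ1 i⟩, ⟨_, hκ2 i⟩]
    have hcard : (s.firstPairs m).ncard = 2 * m := by
      have himg : s.firstPairs m = ℓ '' (((fun i => (κ i).1) '' Set.Iio m) ×ˢ Set.univ) := by
        ext n
        constructor
        · intro hn
          obtain ⟨k, rfl⟩ := hsub n hn
          obtain ⟨i, hi⟩ := hsurj k.1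
          exact ⟨k, ⟨⟨i, (hfirst m i k hi.symm).1 hn, hi⟩, Set.mem_univ _⟩, rfl⟩
        · rintro ⟨k, ⟨⟨i, hi, hik⟩, -⟩, rfl⟩
          exact (hfirst m i k hik.symm).2 hi
      rw [himg, Set.ncard_image_of_injective _ h.injective, Set.ncard_prod,
        Set.ncard_image_of_injective _ hinj, Set.ncard_univ, Nat.card_eq_fintype_card,
        Fintype.card_bool, ← Finset.coe_Iio, Set.ncard_coe_finset, Fin.card_Iio, mul_comm]
    have hdown : ∀ n ∈ s.firstPairs m, (Finset.Icc 1 n : Set ℕ) ⊆ s.firstPairs m := by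
      intro n hn n' hn'
      obtain ⟨k, rfl⟩ := hsub n hn
      simp only [Finset.coe_Icc, Set.mem_Icc] at hn'
      obtain ⟨l, rfl⟩ := h.exists_eq ⟨hn'.1, hn'.2.trans (h.mem_Icc k).2⟩
      rw [hmemT] at hn ⊢
      by_contra hl
      have := h.lt_of_rel _ _ (hsplit _ hn _ hl k.2 l.2)
      exact absurd hn'.2 (not_le.2 this)
    have hfin : (s.firstPairs m).Finite :=
      Set.Finite.subset (Set.finite_range ℓ) fun n hn => hsub n hn
    refine ⟨m, ?_, m.2, ?_⟩
    · have := (hTm i₀).1 ht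
      exact lt_of_le_of_lt (Nat.zero_le _) this
    -- A downward closed set of `2 * m` positive labels has no element above `2 * m`, so it is `{1,
    -- …, 2m}`.
    · refine Set.eq_of_subset_of_ncard_le (fun n hn => ⟨?_, ?_⟩) ?_ (Set.finite_Icc _ _)
      · obtain ⟨k, rfl⟩ := hsub n hn
        exact (h.mem_Icc k).1
      · have := Set.ncard_le_ncard (hdown n hn) hfin
        rwa [Set.ncard_coe_finset, Nat.card_Icc, hcard, Nat.add_sub_cancel] at this
      · rw [hcard, ← Finset.coe_Icc, Set.ncard_coe_finset, Nat.card_Icc, Nat.add_sub_cancel]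
  · rintro ⟨n, hn0, hnd, hn⟩
    refine ⟨{t | ∃ i : Fin d, (i : ℕ) < n ∧ (κ i).1 = t}, ⟨_, ⟨⟨0, by omega⟩, hn0, rfl⟩⟩, ?_, ?_⟩
    · rw [Set.ne_univ_iff_exists_notMem]
      refine ⟨(κ ⟨n, hnd⟩).1, ?_⟩
      rintro ⟨i, hi, hi'⟩
      have := hinj hi'
      simp [this] at hi
    · rintro _ ⟨i, hi, rfl⟩ j hj b b'
      obtain ⟨j, rfl⟩ := hsurj j
      have hj' : ¬ (j : ℕ) < n := fun hlt => hj ⟨j, hlt, rfl⟩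
      refine (h.rel_iff_lt hR ?_).2 ?_
      · intro he
        exact hj ⟨i, hi, he⟩
      · have h1 := (hfirst n i ((κ i).1, b) rfl).2 hi
        have h2 := fun hx => hj' ((hfirst n j ((κ j).1, b') rfl).1 hx)
        rw [hn] at h1 h2
        have h3 := (h.mem_Icc ((κ j).1, b')).1
        simp only [Set.mem_Icc] at h1 h2 h3
        change ℓ ((κ i).1, b) < ℓ ((κ j).1, b')
        by_contra hcon
        exact h2 ⟨h3, by omega⟩

/-- Without a splitting, the pairs form a tree in which every pair but the root starts strictly
inside its parent. -/
theorem IsLabeling.exists_parent {d : ℕ} {R : Fin d × Bool → Fin d × Bool → Prop}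
    {ℓ : Fin d × Bool → ℕ} (h : IsLabeling R ℓ) (hR : IsMultipartite R) (hd : 1 ≤ d)
    (hsplit : ¬ ∃ T, IsSplitting R T) :
    ∃ r : Fin d, ∀ j, j ≠ r → ∃ i,
      min (ℓ (i, true)) (ℓ (i, false)) < min (ℓ (j, true)) (ℓ (j, false)) ∧
      min (ℓ (j, true)) (ℓ (j, false)) < max (ℓ (i, true)) (ℓ (i, false)) := by
  have : Nonempty (Fin d) := ⟨⟨0, hd⟩⟩
  let lo : Fin d → ℕ := fun i => min (ℓ (i, true)) (ℓ (i, false))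
  have hlo : ∀ k, lo k.1 ≤ ℓ k := by
    rintro ⟨i, b⟩
    cases b <;> simp [lo]
  have hhi : ∀ k, ℓ k ≤ max (ℓ (k.1, true)) (ℓ (k.1, false)) := by
    rintro ⟨i, b⟩
    cases b <;> simp
  have hex : ∀ i, ∃ b, ℓ (i, b) = lo i := by
    intro i
    rcases min_choice (ℓ (i, true)) (ℓ (i, false)) with h1 | h1
    exacts [⟨true, h1.symm⟩, ⟨false, h1.symm⟩]
  have hinj : Function.Injective lo := by
    intro i j hij
    obtain ⟨b, hb⟩ := hex i
    obtain ⟨b', hb'⟩ := hex j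
    exact congrArg Prod.fst (h.injective (hb.trans (hij.trans hb'.symm)))
  obtain ⟨r, hr⟩ := Finite.exists_min lo
  refine ⟨r, fun j hj => ?_⟩
  have hrj : lo r < lo j := lt_of_le_of_ne (hr j) fun he => hj (hinj he).symm
  by_contra! hcon
  -- If no earlier interval reaches past the start of `j`, all pairs starting before `j` also end by
  -- then, which is a splitting.
  refine hsplit ⟨{i | lo i < lo j}, ⟨r, hrj⟩, ?_, fun i hi l hl b b' => ?_⟩
  · rw [Set.ne_univ_iff_exists_notMem]
    exact ⟨j, by simp⟩
  · have hne : i ≠ l := by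
      rintro rfl
      exact hl hi
    refine (h.rel_iff_lt hR hne).2 ?_
    have h1 : max (ℓ (i, true)) (ℓ (i, false)) ≤ lo j := hcon i hi
    have h2 : lo j ≤ lo l := not_lt.1 hl
    have h3 := hlo (l, b')
    have h4 := hhi (i, b)
    refine lt_of_le_of_ne (h4.trans (h1.trans (h2.trans h3))) fun he => hne ?_
    exact congrArg Prod.fst (h.injective he)
/-! ### Configurations with prescribed heights -/

theorem exists_rec_along_parent {ι X : Type*} {m : ι → ℕ} {r : ι} {π : ι → ι}
    (hm : ∀ j, j ≠ r → m (π j) < m j) (x₀ : X) (step : ι → X → X) :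
    ∃ h : ι → X, h r = x₀ ∧ ∀ j, j ≠ r → h j = step j (h (π j)) := by
  classical
  let F : (j : ι) → ((i : ι) → m i < m j → X) → X := fun j ih =>
    if hj : j = r then x₀ else step j (ih (π j) (hm j hj))
  let wf : WellFounded fun i j => m i < m j := (measure m).wf
  refine ⟨wf.fix F, ?_, fun j hj => ?_⟩
  · rw [wf.fix_eq]; simp [F]
  · rw [wf.fix_eq]; simp [F, hj]

theorem induction_along_parent {ι : Type*} {m : ι → ℕ} {r : ι} {π : ι → ι}
    (hm : ∀ j, j ≠ r → m (π j) < m j) {p : ι → Prop} (h0 : p r)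
    (hstep : ∀ j, j ≠ r → p (π j) → p j) (j : ι) : p j := by
  induction hn : m j using Nat.strong_induction_on generalizing j with
  | _ n ih =>
    by_cases hj : j = r
    · rwa [hj]
    · exact hstep j hj (ih _ (hn ▸ hm j hj) _ rfl)

/-- Both `x` and `y` lie strictly between `a` and `b`, hence on the same side of `a`. -/
theorem div_pos_of_separated {a b x y : ℝ} (hx : (a - x) * (b - x) < 0)
    (hy : (a - y) * (b - y) < 0) : 0 < (a - x) / (a - y) := by
  rcases mul_neg_iff.1 hx with ⟨h1, h2⟩ | ⟨h1, h2⟩ <;>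
    rcases mul_neg_iff.1 hy with ⟨h3, h4⟩ | ⟨h3, h4⟩
  · exact div_pos h1 h3
  · linarith
  · linarith
  · exact div_pos_of_neg_of_neg h1 h3

/-- An affine function on a segment that attains its upper bound at an interior point is constant.
This carries maximality between a segment and a crossing point on it. -/
theorem forall_bool_eq_iff_of_separated {G w γ : ℝ} {x : Bool → ℝ} (hx : ∀ b, x b * x (!b) < 0)
    (hle : ∀ b, G + x b * w ≤ γ) : (∀ b, G + x b * w = γ) ↔ G = γ := by
  have h1 := hx true
  simp only [Bool.not_true] at h1
  constructor
  · intro h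
    have h2 := h true
    have h3 := h false
    have h4 : (x true - x false) * w = 0 := by linarith
    rcases mul_eq_zero.1 h4 with h5 | h5
    · rw [sub_eq_zero.1 h5] at h1
      exact absurd h1 (not_lt.2 (mul_self_nonneg _))
    · rw [h5] at h2; linarith
  · rintro rfl
    have hw : w = 0 := by
      have h2 := hle true
      have h3 := hle false
      by_contra hne
      have h4 := mul_pos_of_neg_of_neg h1 (neg_neg_of_pos (mul_self_pos.2 hne))
      have h5 := mul_nonneg_of_nonpos_of_nonpos (a := x true * w) (b := x false * w)
        (by linarith) (by linarith)
      nlinarith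
    intro b
    rw [hw]; ring

section Tree

variable {d : ℕ} {t : Fin d × Bool → ℝ} {τ : Fin d → ℝ} {m : Fin d → ℕ} {r : Fin d}
  {π : Fin d → Fin d}

theorem map_base_add_smul_single (g : (Fin d → ℝ) →ₗ[ℝ] ℝ) (p : Fin d → ℝ) (x : ℝ) (j : Fin d) :
    g (p + x • Pi.single j 1) = g p + x * g (Pi.single j 1) := by
  simp

/-- If the intervals `t (i, ·)` form a tree in which adjacent intervals overlap, then the `t k` are
the heights of a crosspolytopal configuration, in which the segments of adjacent pairs cross. -/
theorem exists_isCrossConfig (hm : ∀ j, j ≠ r → m (π j) < m j)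
    (h1 : ∀ j b, (t (j, b) - τ j) * (t (j, !b) - τ j) < 0)
    (h2 : ∀ j, j ≠ r → ∀ b, (t (π j, b) - τ j) * (t (π j, !b) - τ j) < 0) :
    ∃ c, IsCrossConfig c ∧
      ∃ f : (Fin d → ℝ) →ₗ[ℝ] ℝ, ∀ k l, f (c k) < f (c l) ↔ t k < t l := by
  -- The base point `p j` is the point at height `τ j` on the line of the parent; the line of `j`
  -- passes through it in direction `j`.
  obtain ⟨p, hp0, hp⟩ := exists_rec_along_parent hm (0 : Fin d → ℝ)
    fun j x => x + (τ j - τ (π j)) • Pi.single (π j) 1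
  let c : Fin d × Bool → Fin d → ℝ := fun k => p k.1 + (t k - τ k.1) • Pi.single k.1 1
  have hc : ∀ (g : (Fin d → ℝ) →ₗ[ℝ] ℝ) j b,
      g (c (j, b)) = g (p j) + (t (j, b) - τ j) * g (Pi.single j 1) := fun g j b =>
    map_base_add_smul_single g _ _ _
  have hgp : ∀ (g : (Fin d → ℝ) →ₗ[ℝ] ℝ) j, j ≠ r →
      g (p j) = g (p (π j)) + (τ j - τ (π j)) * g (Pi.single (π j) 1) := fun g j hj => by
    rw [hp j hj, map_base_add_smul_single]
  have hex : ∀ w : Fin d → ℝ, ∃ g : (Fin d → ℝ) →ₗ[ℝ] ℝ, ∀ j, g (Pi.single j 1) = w j :=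
    fun w => ⟨(Pi.basisFun ℝ (Fin d)).constr ℝ w, fun j => by
      rw [← Pi.basisFun_apply, Module.Basis.constr_basis]⟩
  refine ⟨c, ⟨fun σ => ?_, fun g γ hle i hi => ?_⟩, ?_⟩
  · have hne : ∀ j, t (j, σ j) - τ j ≠ 0 := fun j h0 => by
      have := h1 j (σ j)
      rw [h0, zero_mul] at this
      exact lt_irrefl _ this
    -- Here `z j` is the slack `1 - g (p j)`. On the parent's line `g` rises to `1` at the selected
    -- endpoint, so the slack scales with the distance to that endpoint.
    obtain ⟨z, hz0, hz⟩ := exists_rec_along_parent hm (1 : ℝ) fun j x =>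
      x * ((t (π j, σ (π j)) - τ j) / (t (π j, σ (π j)) - τ (π j)))
    have hzpos : ∀ j, 0 < z j := induction_along_parent hm (by rw [hz0]; exact one_pos)
      fun j hj ih => by
        rw [hz j hj]
        exact mul_pos ih (div_pos_of_separated (h2 j hj _) (h1 (π j) _))
    obtain ⟨g, hg⟩ := hex fun j => z j / (t (j, σ j) - τ j)
    have hG : ∀ j, g (p j) = 1 - z j := induction_along_parent hm (by simp [hp0, hz0])
      fun j hj ih => by
        rw [hgp g j hj, ih, hz j hj, hg]
        have := hne (π j)
        field_simp
        ring
    refine ⟨g, 1, fun j => ⟨?_, ?_⟩⟩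
    · rw [hc, hG, hg]
      have := hne j
      field_simp
      ring
    · rw [hc, hG, hg]
      have h3 : (t (j, !σ j) - τ j) * (z j / (t (j, σ j) - τ j)) < 0 := by
        have h4 : (t (j, !σ j) - τ j) * (z j / (t (j, σ j) - τ j)) =
            z j * ((t (j, σ j) - τ j) * (t (j, !σ j) - τ j)) / (t (j, σ j) - τ j) ^ 2 := by
          have := hne j
          field_simp
        rw [h4]
        exact div_neg_of_neg_of_pos (mul_neg_of_pos_of_neg (hzpos j) (h1 j _))
          (by have := hne j; positivity)
      have := hzpos j
      linarith
  · have hboth : ∀ j, (∀ b, g (c (j, b)) = γ) ↔ g (p j) = γ := by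
      intro j
      simp only [hc]
      refine forall_bool_eq_iff_of_separated (x := fun b => t (j, b) - τ j) (h1 j) fun b => ?_
      rw [← hc]
      exact hle _
    have hparent : ∀ j, j ≠ r → ((∀ b, g (c (π j, b)) = γ) ↔ g (p j) = γ) := by
      intro j hj
      have hval : ∀ b, g (c (π j, b)) =
          g (p j) + (t (π j, b) - τ j) * g (Pi.single (π j) 1) := by
        intro b
        rw [hc, hgp g j hj]
        ring
      simp only [hval]
      refine forall_bool_eq_iff_of_separated (x := fun b => t (π j, b) - τ j) (h2 j hj) fun b => ?_
      rw [← hval]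
      exact hle _
    have hroot : ∀ j, (∀ b, g (c (j, b)) = γ) ↔ ∀ b, g (c (r, b)) = γ :=
      induction_along_parent hm Iff.rfl fun j hj ih => by
        rw [hboth, ← hparent j hj, ih]
    rintro ⟨j, b⟩
    exact (hroot j).2 ((hroot i).1 hi) b
  -- All directions have slope `1`, so heights are measured consistently on all lines, relative to
  -- `τ r`.
  · obtain ⟨f, hf⟩ := hex fun _ => 1
    have hF : ∀ j, f (p j) = τ j - τ r := induction_along_parent hm (by simp [hp0])
      fun j hj ih => by
        rw [hgp f j hj, ih, hf]
        ring
    refine ⟨f, fun k l => ?_⟩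
    have hval : ∀ k, f (c k) = t k - τ r := by
      rintro ⟨j, b⟩
      rw [hc, hF, hf]
      ring
    rw [hval, hval, sub_lt_sub_iff_right]

end Tree

theorem sub_half_mul_sub_half_neg {x y a : ℕ} (h1 : min x y ≤ a) (h2 : a < max x y) :
    ((x : ℝ) - (a + 1 / 2)) * ((y : ℝ) - (a + 1 / 2)) < 0 := by
  rcases le_total x y with h | h
  · rw [min_eq_left h] at h1
    rw [max_eq_right h] at h2
    have h3 : (x : ℝ) ≤ a := by exact_mod_cast h1
    have h4 : (a : ℝ) + 1 ≤ y := by exact_mod_cast h2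
    exact mul_neg_of_neg_of_pos (by linarith) (by linarith)
  · rw [min_eq_right h] at h1
    rw [max_eq_left h] at h2
    have h3 : (y : ℝ) ≤ a := by exact_mod_cast h1
    have h4 : (a : ℝ) + 1 ≤ x := by exact_mod_cast h2
    exact mul_neg_of_pos_of_neg (by linarith) (by linarith)

/-- A labeling without splitting is induced by a linear functional on a crosspolytopal
configuration. -/
theorem IsLabeling.exists_isCrossConfig {d : ℕ} {R : Fin d × Bool → Fin d × Bool → Prop}
    {ℓ : Fin d × Bool → ℕ} (h : IsLabeling R ℓ) (hR : IsMultipartite R) (hd : 1 ≤ d)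
    (hsplit : ¬ ∃ T, IsSplitting R T) :
    ∃ c, IsCrossConfig c ∧
      ∃ f : (Fin d → ℝ) →ₗ[ℝ] ℝ, ∀ k l, f (c k) < f (c l) ↔ ℓ k < ℓ l := by
  obtain ⟨r, hr⟩ := h.exists_parent hR hd hsplit
  have hpar : ∀ j, ∃ i, j ≠ r →
      min (ℓ (i, true)) (ℓ (i, false)) < min (ℓ (j, true)) (ℓ (j, false)) ∧
      min (ℓ (j, true)) (ℓ (j, false)) < max (ℓ (i, true)) (ℓ (i, false)) := by
    intro j
    by_cases hj : j = r
    · exact ⟨r, fun h => absurd hj h⟩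
    · obtain ⟨i, hi⟩ := hr j hj
      exact ⟨i, fun _ => hi⟩
  choose π hπ using hpar
  let lo : Fin d → ℕ := fun i => min (ℓ (i, true)) (ℓ (i, false))
  obtain ⟨c, hc, f, hf⟩ := _root_.exists_isCrossConfig (t := fun k => (ℓ k : ℝ))
    -- The crossing height lies just above the start of `j`; the half keeps it off all labels and
    -- strictly inside both intervals.
    (τ := fun j => (lo j : ℝ) + 1 / 2) (m := lo) (r := r) (π := π) (fun j hj => (hπ j hj).1)
    (fun j b => by
      have hne : ℓ (j, true) ≠ ℓ (j, false) := h.injective.ne (by simp)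
      have key := sub_half_mul_sub_half_neg (x := ℓ (j, true)) (y := ℓ (j, false)) (a := lo j)
        le_rfl (min_lt_max.2 hne)
      cases b
      · rw [mul_comm]; exact key
      · exact key)
    (fun j hj b => by
      have key := sub_half_mul_sub_half_neg (x := ℓ (π j, true)) (y := ℓ (π j, false)) (a := lo j)
        (hπ j hj).1.le (hπ j hj).2
      cases b
      · rw [mul_comm]; exact key
      · exact key)
  exact ⟨c, hc, f, fun k l => by rw [hf, Nat.cast_lt]⟩

/-! ### The standard crosspolytope -/

/-- The vertices of the standard crosspolytope, as points. -/
def crossPoint {d : ℕ} (k : Fin d × Bool) : Fin d → ℝ :=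
  if k.2 then Pi.single k.1 1 else -Pi.single k.1 1

theorem crossPoint_flipLabel {d : ℕ} (k : Fin d × Bool) :
    crossPoint (flipLabel k) = -crossPoint k := by
  obtain ⟨i, b⟩ := k
  cases b <;> simp [crossPoint, flipLabel]

theorem crosspolytope_eq (d : ℕ) : crosspolytope d = convexHull ℝ (Set.range crossPoint) := by
  unfold crosspolytope
  congr 1
  ext x
  simp only [Set.mem_ofPred_eq, Set.mem_range, Prod.exists, Bool.exists_bool, crossPoint]
  simp only [if_true, Bool.false_eq_true, if_false, eq_comm (b := x), or_comm]

theorem isCrossConfig_crossPoint (d : ℕ) : IsCrossConfig (crossPoint (d := d)) := by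
  constructor
  · intro σ
    refine ⟨(Pi.basisFun ℝ (Fin d)).constr ℝ fun i => if σ i then (1 : ℝ) else -1, 1, fun i => ?_⟩
    have hval : (Pi.basisFun ℝ (Fin d)).constr ℝ (fun i => if σ i then (1 : ℝ) else -1)
        (Pi.single i 1) = if σ i then (1 : ℝ) else -1 := by
      rw [← Pi.basisFun_apply, Module.Basis.constr_basis]
    cases h : σ i <;> simp only [crossPoint, h, Bool.not_false, Bool.not_true, if_true,
      Bool.false_eq_true, if_false, map_neg, hval] <;> norm_num
  · intro g γ hle i hi
    have h1 := hi true
    have h2 := hi false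
    simp only [crossPoint, if_true, Bool.false_eq_true, if_false, map_neg] at h1 h2
    have hγ : γ = 0 := by linarith
    rintro ⟨j, b⟩
    have h3 := hle (j, true)
    have h4 := hle (j, false)
    simp only [crossPoint, if_true, Bool.false_eq_true, if_false, map_neg] at h3 h4
    cases b <;> simp only [crossPoint, if_true, Bool.false_eq_true, if_false, map_neg] <;> linarith

/-- The vertices of the standard crosspolytope. -/
def crossVertex {d : ℕ} (k : Fin d × Bool) : PolytopeVertex (crosspolytope d) :=
  (isCrossConfig_crossPoint d).vertex (crosspolytope_eq d) k

theorem crossVertex_bijective (d : ℕ) : Function.Bijective (crossVertex (d := d)) :=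
  (isCrossConfig_crossPoint d).vertex_bijective (crosspolytope_eq d)

/-- No converse holds: for `d = 1` the two antipodal vertices are themselves joined by an edge. -/
theorem adj_crossVertex {d : ℕ} {k l : Fin d × Bool} (h : k.1 ≠ l.1) :
    (polytopeGraph (crosspolytope d)).Adj (crossVertex k) (crossVertex l) :=
  (isCrossConfig_crossPoint d).adj_vertex (crosspolytope_eq d) h

theorem isAntipodalPair_crossVertex {d : ℕ} {k l : Fin d × Bool} :
    IsAntipodalPair (crossVertex k) (crossVertex l) ↔ l = flipLabel k := by
  change crossPoint l = -crossPoint k ↔ _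
  rw [← crossPoint_flipLabel, (isCrossConfig_crossPoint d).injective.eq_iff]

/-! ### From orientations of the crosspolytope to relations on labels -/

section Orientation

variable {d : ℕ} (O : EdgeOrientation (polytopeGraph (crosspolytope d)))

/-- The orientation, as a relation on labels. -/
def EdgeOrientation.labelRel (k l : Fin d × Bool) : Prop :=
  O.Dir (crossVertex k) (crossVertex l)

theorem EdgeOrientation.isMultipartite_labelRel : IsMultipartite O.labelRel := fun _ _ h =>
  O.dir_iff_not _ _ (adj_crossVertex h)

variable {O}

theorem EdgeOrientation.IsAcyclic.labelRel (hO : O.IsAcyclic) (k : Fin d × Bool) :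
    ¬ Relation.TransGen O.labelRel k k := fun h =>
  hO (crossVertex k) (h.lift crossVertex fun _ _ h => h)

theorem exists_isInitialSet_iff :
    (∃ S : Set (PolytopeVertex (crosspolytope d)),
      S.Nonempty ∧ S ≠ Set.univ ∧ IsUnionOfPairs S ∧ O.IsInitialSet S) ↔
    ∃ T, IsSplitting O.labelRel T := by
  constructor
  · rintro ⟨S, ⟨v, hv⟩, hS, hpairs, hinit⟩
    have hmem : ∀ k l : Fin d × Bool, k.1 = l.1 → crossVertex l ∈ S → crossVertex k ∈ S := by
      intro k l hkl hl
      rcases eq_or_eq_flipLabel hkl with rfl | h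
      · exact hl
      · exact hpairs _ _ (isAntipodalPair_crossVertex.2 h) hl
    obtain ⟨w, hw⟩ := (Set.ne_univ_iff_exists_notMem S).1 hS
    obtain ⟨k, rfl⟩ := (crossVertex_bijective d).2 v
    obtain ⟨l, rfl⟩ := (crossVertex_bijective d).2 w
    refine ⟨{i | crossVertex (i, true) ∈ S}, ⟨k.1, hmem (k.1, true) k rfl hv⟩, ?_, fun i hi j hj b b' => ?_⟩
    · rw [Set.ne_univ_iff_exists_notMem]
      exact ⟨l.1, fun hl => hw (hmem l (l.1, true) rfl hl)⟩
    · have h1 : crossVertex (i, b) ∈ S := hmem _ (i, true) rfl hi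
      have h2 : crossVertex (j, b') ∉ S := fun h => hj (hmem (j, true) (j, b') rfl h)
      refine hinit _ h1 _ h2 (adj_crossVertex ?_)
      rintro rfl
      exact hj hi
  · rintro ⟨T, ⟨i, hi⟩, hT, hsplit⟩
    obtain ⟨j, hj⟩ := (Set.ne_univ_iff_exists_notMem T).1 hT
    have hmem : ∀ k, crossVertex k ∈ crossVertex '' {k | k.1 ∈ T} ↔ k.1 ∈ T := fun k =>
      (crossVertex_bijective d).1.mem_set_image
    refine ⟨crossVertex '' {k | k.1 ∈ T}, ⟨_, (hmem (i, true)).2 hi⟩, ?_, ?_, ?_⟩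
    · rw [Set.ne_univ_iff_exists_notMem]
      exact ⟨_, fun h => hj ((hmem (j, true)).1 h)⟩
    · intro v w hvw hv
      obtain ⟨k, rfl⟩ := (crossVertex_bijective d).2 v
      obtain ⟨l, rfl⟩ := (crossVertex_bijective d).2 w
      rw [isAntipodalPair_crossVertex.1 hvw]
      exact (hmem _).2 ((hmem k).1 hv)
    · intro v hv w hw _
      obtain ⟨k, rfl⟩ := (crossVertex_bijective d).2 v
      obtain ⟨l, rfl⟩ := (crossVertex_bijective d).2 w
      exact hsplit _ ((hmem k).1 hv) _ (fun h => hw ((hmem l).2 h)) k.2 l.2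

theorem isPairSequenceOf_iff {s : PairSequence d} :
    IsPairSequenceOf O s ↔ ∃ ℓ, IsLabeling O.labelRel ℓ ∧ IsLabeling.HasPairs ℓ s := by
  let E := Equiv.ofBijective _ (crossVertex_bijective d)
  constructor
  · rintro ⟨ℓ, hbij, hlt, hs⟩
    refine ⟨ℓ ∘ crossVertex, ⟨hbij.comp E.bijective.bijOn_univ, fun k l h => hlt _ _ h⟩,
      fun i => ?_⟩
    obtain ⟨v, w, hvw, hv, hw⟩ := hs i
    obtain ⟨k, rfl⟩ := (crossVertex_bijective d).2 v
    obtain ⟨l, rfl⟩ := (crossVertex_bijective d).2 w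
    obtain rfl := isAntipodalPair_crossVertex.1 hvw
    exact ⟨k, hv, hw⟩
  · rintro ⟨ℓ, hℓ, hs⟩
    have hE : ∀ k, E.symm (crossVertex k) = k := E.symm_apply_apply
    refine ⟨ℓ ∘ E.symm, hℓ.bijOn.comp E.symm.bijective.bijOn_univ, fun v w h => ?_, fun i => ?_⟩
    · obtain ⟨k, rfl⟩ := (crossVertex_bijective d).2 v
      obtain ⟨l, rfl⟩ := (crossVertex_bijective d).2 w
      simp only [Function.comp_apply, hE]
      exact hℓ.lt_of_rel _ _ h
    · obtain ⟨k, hk1, hk2⟩ := hs i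
      refine ⟨crossVertex k, crossVertex (flipLabel k), isAntipodalPair_crossVertex.2 rfl, ?_, ?_⟩
      · simpa only [Function.comp_apply, hE] using hk1
      · simpa only [Function.comp_apply, hE] using hk2

/-- The images of the vertices under an isomorphism of face lattices keep their transversal
facets. -/
theorem exists_transversal_functional (hd : 1 ≤ d) {Q : Set (Fin d → ℝ)}
    (φ : PolytopeFace (crosspolytope d) ≃o PolytopeFace Q)
    (e : PolytopeVertex (crosspolytope d) → PolytopeVertex Q)
    (he : ∀ v, φ v.toFace = (e v).toFace) (σ : Fin d → Bool) :
    ∃ (g : (Fin d → ℝ) →ₗ[ℝ] ℝ) (γ : ℝ),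
      ∀ i, g (e (crossVertex (i, σ i))).1 = γ ∧ g (e (crossVertex (i, !σ i))).1 < γ := by
  have hA : IsFaceLabelSet {k : Fin d × Bool | k.2 = σ k.1} := by
    right
    intro i b h1 h2
    simp only [Set.mem_ofPred_eq] at h1 h2
    rw [← h1] at h2
    simp at h2
  let ψ := (isCrossConfig_crossPoint d).faceIso (crosspolytope_eq d)
  -- Vertex incidence with `F` is an order relation between faces, so `φ` transports it from the
  -- standard crosspolytope.
  let F : PolytopeFace Q := φ (ψ.symm ⟨_, hA⟩)
  have hmem : ∀ k : Fin d × Bool, (e (crossVertex k)).1 ∈ F.1 ↔ k.2 = σ k.1 := by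
    intro k
    have h1 : (e (crossVertex k)).1 ∈ F.1 ↔ (e (crossVertex k)).toFace ≤ F :=
      Set.singleton_subset_iff.symm
    rw [h1, ← he, φ.le_iff_le, ← ψ.le_iff_le, ψ.apply_symm_apply]
    change (isCrossConfig_crossPoint d).faceIso _ (IsCrossConfig.vertex _ _ k).toFace ≤ _ ↔ _
    rw [IsCrossConfig.faceIso_toFace]
    exact Set.singleton_subset_iff
  have hsub : ∀ k, (e (crossVertex k)).1 ∈ Q := fun k =>
    (e (crossVertex k)).2.subset (Set.mem_singleton _)
  -- The empty face is exposed by convention, without a functional; `1 ≤ d` provides a vertex on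
  -- `F`.
  have hne : F.1.Nonempty := ⟨_, (hmem (⟨0, hd⟩, σ ⟨0, hd⟩)).2 rfl⟩
  obtain ⟨l, hl⟩ := F.2 hne
  obtain ⟨z, hz⟩ := hne
  rw [hl] at hz
  refine ⟨l.toLinearMap, l z, fun i => ⟨?_, ?_⟩⟩
  · have h1 := (hmem (i, σ i)).2 rfl
    rw [hl] at h1
    exact le_antisymm (hz.2 _ h1.1) (h1.2 _ hz.1)
  · refine lt_of_le_of_ne (hz.2 _ (hsub _)) fun h => ?_
    have h1 : (e (crossVertex (i, !σ i))).1 ∈ F.1 := by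
      rw [hl]
      refine ⟨hsub _, fun y hy => ?_⟩
      change l _ = l z at h
      rw [h]
      exact hz.2 y hy
    have := (hmem _).1 h1
    simp at this

theorem isLPOrientation_iff (hd : 1 ≤ d) (hO : O.IsAcyclic) :
    IsLPOrientation O ↔ ¬ ∃ T, IsSplitting O.labelRel T := by
  constructor
  · rintro ⟨Q, -, φ, e, f, he, hf⟩ ⟨T, hT, hT', hsplit⟩
    refine not_separated_of_transversal (q := fun k => (e (crossVertex k)).1)
      (exists_transversal_functional hd φ e he) f hT hT' fun i hi j hj b b' => ?_
    refine (hf _ _ (adj_crossVertex ?_)).1 (hsplit i hi j hj b b')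
    rintro rfl
    exact hj hi
  · intro h
    obtain ⟨ℓ, hℓ⟩ := exists_isLabeling hO.labelRel
    obtain ⟨c, hc, f, hf⟩ := hℓ.exists_isCrossConfig O.isMultipartite_labelRel hd h
    let E := Equiv.ofBijective _ (crossVertex_bijective d)
    have hE : ∀ k, E.symm (crossVertex k) = k := E.symm_apply_apply
    refine ⟨convexHull ℝ (Set.range c), ⟨Finset.univ.image c, by simp⟩,
      ((isCrossConfig_crossPoint d).faceIso (crosspolytope_eq d)).trans (hc.faceIso rfl).symm,
      fun v => hc.vertex rfl (E.symm v), f, fun v => ?_, fun v w hvw => ?_⟩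
    · obtain ⟨k, rfl⟩ := (crossVertex_bijective d).2 v
      simp only [hE]
      rw [OrderIso.trans_apply, OrderIso.symm_apply_eq, IsCrossConfig.faceIso_toFace]
      exact IsCrossConfig.faceIso_toFace _ _ k
    · obtain ⟨k, rfl⟩ := (crossVertex_bijective d).2 v
      obtain ⟨l, rfl⟩ := (crossVertex_bijective d).2 w
      simp only [hE]
      refine Iff.trans ⟨hℓ.lt_of_rel k l, fun hlt => ?_⟩ (hf k l).symm
      refine (O.dir_iff_not _ _ hvw).2 fun h => ?_
      exact lt_asymm hlt (hℓ.lt_of_rel l k h)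

end Orientation

theorem mainTheorem2 (d : ℕ) (hd : 1 ≤ d)
    (O : EdgeOrientation (polytopeGraph (crosspolytope d))) (hO : O.IsAcyclic) :
    (IsLPOrientation O ↔
      ¬ ∃ S : Set (PolytopeVertex (crosspolytope d)),
        S.Nonempty ∧ S ≠ Set.univ ∧ IsUnionOfPairs S ∧ O.IsInitialSet S) ∧
    (∃! s : PairSequence d, IsPairSequenceOf O s) ∧
    (∀ s : PairSequence d, IsPairSequenceOf O s →
      (IsLPOrientation O ↔
        ∀ k : ℕ, 0 < k → k < d → s.firstPairs k ≠ Set.Icc 1 (2 * k))) := by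
  have hR := O.isMultipartite_labelRel
  refine ⟨?_, ?_, fun s hs => ?_⟩
  · rw [isLPOrientation_iff hd hO, exists_isInitialSet_iff]
  · obtain ⟨ℓ, hℓ⟩ := exists_isLabeling hO.labelRel
    obtain ⟨s, hs⟩ := hℓ.exists_hasPairs
    refine ⟨s, isPairSequenceOf_iff.2 ⟨ℓ, hℓ, hs⟩, fun s' h => ?_⟩
    obtain ⟨ℓ', hℓ', hs'⟩ := isPairSequenceOf_iff.1 h
    exact hℓ'.hasPairs_unique hℓ hR hs' hs
  · obtain ⟨ℓ, hℓ, hs⟩ := isPairSequenceOf_iff.1 hs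
    rw [isLPOrientation_iff hd hO, hℓ.exists_isSplitting_iff hR hs]
    push Not
    rfl
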